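/- Let $B=\nabla\times A$ be a smooth, nowhere vanishing magnetic field on $\mathbb R^3$, and consider the Lorentz force equation $\dot x=v$, $\dot v=\epsilon^{-1}v\times B(x)$. Write $\fint h=(2\pi)^{-1}\int_0^{2\pi}h(\theta)\,d\theta$. *Coordinates.* Let $(\zeta,\xi)$, with $\zeta$ an angle mod $2\pi$ and $\xi$ in an open set $D\subset\mathbb R^5$, be smooth coordinates on an open part of the phase space in which, for every $\epsilon\ne0$, the Lorentz force equation reads $\dot\zeta=\epsilon^{-1}\Omega_{-1}(\xi)+\Omega_0(\zeta,\xi)$, $\dot\xi=U_0(\zeta,\xi)$, with $\Omega_{-1}$ nowhere zero on $D$ and all three functions smooth and $2\pi$-periodic in $\zeta$. Assume that on loops $\widetilde\zeta(\theta)=\theta+\widetilde\nu(\theta)$, $\widetilde\xi(\theta)$ (with $\widetilde\nu,\widetilde\xi$ smooth and $2\pi$-periodic, $\widetilde\xi$ and its mean in $D$) the loop frequency functional $\epsilon^{-1}|B(\fint\widetilde x)|$ is $\epsilon^{-1}\omega_c$, where $\omega_c(\widetilde\zeta,\widetilde\xi)=\Omega_{-1}(\fint\widetilde\xi)$. *Kruskal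 transformation.* Let $\Phi_\epsilon=\mathrm{id}+\epsilon\varphi_1+\epsilon^2\varphi_2+\cdots:(\zeta,\xi)\mapsto(\underline\zeta,\underline\xi)$ be a formal transformation with smooth coefficients, $2\pi$-periodic in $\zeta$, which to all orders in $\epsilon$ brings the Lorentz force equation to the form of the all-orders guiding center equations $$\dot{\underline\zeta}=\tfrac1\epsilon\Omega_{-1}(\underline\xi)+\overline\Omega_\epsilon(\underline\xi),\qquad \dot{\underline\xi}=\overline U_\epsilon(\underline\xi),$$ with $\overline\Omega_\epsilon,\overline U_\epsilon$ formal power series in $\epsilon$. Let $\widetilde\Phi_\epsilon^{-1}$ denote the inverse of $\Phi_\epsilon$ applied pointwise to loops. *Loop space dynamics.* In the transformed variables the Lorentz-force loop space dynamics is $$\partial_t\widetilde{\underline\zeta}+\tfrac1\epsilon\omega\,\partial_\theta\widetilde{\underline\zeta}=\tfrac1\epsilon\Omega_{-1}(\widetilde{\underline\xi})+\overline\Omega_\epsilon(\widetilde{\underline\xi}),\quad \partial_t\widetilde{\underline\xi}+\tfrac1\epsilon\omega\,\partial_\theta\widetilde{\underline\xi}=\overline U_\epsilon(\widetilde{\underline\xi}),\quad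 \dot S=\tfrac1\epsilon\omega,\qquad \omega=\omega_c\big(\widetilde\Phi_\epsilon^{-1}(\widetilde{\underline\zeta},\widetilde{\underline\xi})\big).$$ Put $\widetilde{\underline\zeta}(\theta)=\theta+\bar\nu+\hat\nu(\theta)$, $\widetilde{\underline\xi}(\theta)=\bar\xi+\epsilon\hat\varrho(\theta)$, $\mathcal S=\epsilon S$, where $\hat\nu,\hat\varrho$ are smooth, $2\pi$-periodic and of zero mean; the slow variables are $x=(\bar\nu,\bar\xi,\mathcal S)$ with $\bar\xi\in D$, the fast variables $y=(\hat\nu,\hat\varrho)$. The dynamics takes the form $\dot x=g_\epsilon(x,y)$, $\epsilon\dot y=f_\epsilon(x,y)$. A *formal slow manifold* is a formal power series $y_\epsilon^*(x)=\sum_k\epsilon^ky_k^*(x)$, with coefficients smooth in $x$, that satisfies $\epsilon\,Dy^*_\epsilon(x)[g_\epsilon(x,y^*_\epsilon(x))]=f_\epsilon(x,y^*_\epsilon(x))$ to all orders in $\epsilon$. **Theorem.** The series $g_\epsilon$ and $f_\epsilon$ contain no negative powers of $\epsilon$, and there is exactly one formal slow manifold, namely $y^*_\epsilon=0$. The generator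 $\dot x=g_\epsilon(x,y_\epsilon^*(x))$ on it is, to all orders in $\epsilon$, $$\dot{\bar\nu}=\overline\Omega_\epsilon(\bar\xi)+\delta\omega_\epsilon(\bar\nu,\bar\xi),\qquad \dot{\bar\xi}=\overline U_\epsilon(\bar\xi),\qquad \dot{\mathcal S}=\omega_c\big(\widetilde\Phi_\epsilon^{-1}(\widetilde{\underline\zeta}^*,\widetilde{\underline\xi}^*)\big),$$ where $\widetilde{\underline\zeta}^*(\theta)=\theta+\bar\nu$, $\widetilde{\underline\xi}^*(\theta)=\bar\xi$ and $$\delta\omega_\epsilon(\bar\nu,\bar\xi)=\tfrac1\epsilon\Omega_{-1}(\bar\xi)-\tfrac1\epsilon\omega_c\big(\widetilde\Phi_\epsilon^{-1}(\widetilde{\underline\zeta}^*,\widetilde{\underline\xi}^*)\big)=O(1).$$ Hence motion on the formal slow manifold is equivalent to all-orders guiding center dynamics: the evolution of $(\bar\nu,\bar\xi)$ is independent of $\mathcal S$, and a velocity $(\dot{\bar\nu},\dot{\bar\xi},\dot{\mathcal S})$ is the one above if and only if $\underline\zeta=\bar\nu+\mathcal S/\epsilon$, $\underline\xi=\bar\xi$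 obey the all-orders guiding center equations and $\mathcal S$ obeys its equation above. -/

import Mathlib

open scoped ContDiff

namespace SlowLoops

noncomputable section

/-! ### Formal power series in `ε` and averages of loops -/

/-- Formal power series `a₀ + ε a₁ + ε² a₂ + ⋯` with coefficients in `E`. -/
abbrev Formal (E : Type*) : Type _ := ℕ → E

/-- The series `c + 0 ε + 0 ε² + ⋯`. -/
def constSeries {E : Type*} [Zero E] (c : E) : Formal E
  | 0 => c
  | _ + 1 => 0

/-- Multiplication of a formal series by `ε`. -/
def epsMul {E : Type*} [Zero E] (a : Formal E) : Formal E
  | 0 => 0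
  | n + 1 => a n

/-- The formal series `F (a₀ + ε a₁ + ε² a₂ + ⋯)` for a function `F` that is smooth near `a₀`:
its `n`-th coefficient is the `n`-th Taylor coefficient at `ε = 0` of
`ε ↦ F (a₀ + ε a₁ + ⋯ + εⁿ aₙ)`. -/
def substFun {E G : Type*} [NormedAddCommGroup E] [NormedSpace ℝ E]
    [NormedAddCommGroup G] [NormedSpace ℝ G] (F : E → G) (a : Formal E) : Formal G :=
  fun n => ((n.factorial : ℝ)⁻¹) •
    iteratedDeriv n (fun ε : ℝ => F (∑ k ∈ Finset.range (n + 1), ε ^ k • a k)) 0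

/-- The formal series `∑ⱼ εʲ Fⱼ (a₀ + ε a₁ + ⋯)` for a formal series of functions `F`. -/
def subst {E G : Type*} [NormedAddCommGroup E] [NormedSpace ℝ E]
    [NormedAddCommGroup G] [NormedSpace ℝ G] (F : Formal (E → G)) (a : Formal E) : Formal G :=
  fun n => ∑ p ∈ Finset.HasAntidiagonal.antidiagonal n, substFun (F p.1) a p.2

/-- The average `(2π)⁻¹ ∫₀^{2π} h(θ) dθ`. Loops are `2π`-periodic functions on `ℝ`. -/
def loopMean {E : Type*} [NormedAddCommGroup E] [NormedSpace ℝ E] (h : ℝ → E) : E :=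
  (2 * Real.pi)⁻¹ • ∫ θ in (0 : ℝ)..(2 * Real.pi), h θ

/-! ### The Lorentz force -/

/-- Physical space. -/
abbrev R3 : Type := EuclideanSpace ℝ (Fin 3)

/-- The space in which the five coordinates `ξ = (ξ¹, …, ξ⁵)` take their values. -/
abbrev R5 : Type := EuclideanSpace ℝ (Fin 5)

/-- The cross product of `ℝ³`. -/
def cross (a b : R3) : R3 :=
  !₂[a 1 * b 2 - a 2 * b 1, a 2 * b 0 - a 0 * b 2, a 0 * b 1 - a 1 * b 0]

/-- `∂Aⱼ/∂xᵢ`. -/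
def partialD (A : R3 → R3) (i j : Fin 3) (x : R3) : ℝ :=
  (fderiv ℝ A x (EuclideanSpace.single i 1)) j

/-- The curl of a vector field. -/
def curl (A : R3 → R3) (x : R3) : R3 :=
  !₂[partialD A 1 2 x - partialD A 2 1 x,
     partialD A 2 0 x - partialD A 0 2 x,
     partialD A 0 1 x - partialD A 1 0 x]

/-- A smooth, nowhere vanishing magnetic field that is the curl of a vector potential. -/
structure MagneticField where
  B : R3 → R3
  smooth : ContDiff ℝ ∞ B
  exists_potential : ∃ A : R3 → R3, ContDiff ℝ ∞ A ∧ ∀ x, B x = curl A x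
  ne_zero : ∀ x, B x ≠ 0

/-- The vector field `ẋ = v`, `v̇ = ε⁻¹ v × B(x)` on the phase space `ℝ³ × ℝ³`. -/
def lorentzField (M : MagneticField) (ε : ℝ) (p : R3 × R3) : R3 × R3 :=
  (p.2, ε⁻¹ • cross p.2 (M.B p.1))

/-! ### Kruskal's coordinates -/

/-- Coordinates `(ζ, ξ)` on (an open part of) the phase space of a charged particle, `ζ` being an
angle and `ξ` ranging over an open set `D`, in which the Lorentz force equation reads
`ζ̇ = ε⁻¹ Ω₋₁(ξ) + Ω₀(ζ, ξ)`, `ξ̇ = U₀(ζ, ξ)` with `Ω₋₁` nowhere zero, and such that the frequency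
`ε⁻¹ |B(x̄)|` of loop space dynamics, `x̄` the mean position of a loop, is `ε⁻¹ Ω₋₁(ξ̄)`, where `ξ̄` is
the mean of `ξ` over the loop `θ ↦ (θ + ν(θ), ξ(θ))`. -/
structure KruskalCoordinates (M : MagneticField) where
  D : Set R5
  isOpen_D : IsOpen D
  /-- the phase point `(x, v)` with coordinates `(ζ, ξ)` -/
  point : ℝ × R5 → R3 × R3
  point_smooth : ContDiffOn ℝ ∞ point (Set.univ ×ˢ D)
  point_eq_iff : ∀ ζ ζ' : ℝ, ∀ ξ ∈ D, ∀ ξ' ∈ D,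
    point (ζ, ξ) = point (ζ', ξ') ↔ ξ = ξ' ∧ ∃ m : ℤ, ζ' = ζ + m * (2 * Real.pi)
  point_immersive : ∀ ζ : ℝ, ∀ ξ ∈ D, Function.Bijective (fderiv ℝ point (ζ, ξ))
  Ωm : R5 → ℝ
  Ω₀ : ℝ × R5 → ℝ
  U₀ : ℝ × R5 → R5
  Ωm_smooth : ContDiffOn ℝ ∞ Ωm D
  Ωm_ne_zero : ∀ ξ ∈ D, Ωm ξ ≠ 0
  Ω₀_smooth : ContDiffOn ℝ ∞ Ω₀ (Set.univ ×ˢ D)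
  U₀_smooth : ContDiffOn ℝ ∞ U₀ (Set.univ ×ˢ D)
  Ω₀_periodic : ∀ ζ : ℝ, ∀ ξ ∈ D, Ω₀ (ζ + 2 * Real.pi, ξ) = Ω₀ (ζ, ξ)
  U₀_periodic : ∀ ζ : ℝ, ∀ ξ ∈ D, U₀ (ζ + 2 * Real.pi, ξ) = U₀ (ζ, ξ)
  lorentz : ∀ ε : ℝ, ε ≠ 0 → ∀ ζ : ℝ, ∀ ξ ∈ D,
    fderiv ℝ point (ζ, ξ) (ε⁻¹ * Ωm ξ + Ω₀ (ζ, ξ), U₀ (ζ, ξ)) =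
      lorentzField M ε (point (ζ, ξ))
  frequency : ∀ (ν : ℝ → ℝ) (ξ : ℝ → R5), ContDiff ℝ ∞ ν → ContDiff ℝ ∞ ξ →
    Function.Periodic ν (2 * Real.pi) → Function.Periodic ξ (2 * Real.pi) →
    (∀ θ, ξ θ ∈ D) → loopMean ξ ∈ D →
    ‖M.B (loopMean fun θ => (point (θ + ν θ, ξ θ)).1)‖ = Ωm (loopMean ξ)

/-- `ε` times the Lorentz force vector field in the coordinates `z = (ζ, ξ)`, that is
`(Ω₋₁(ξ), 0) + ε (Ω₀(z), U₀(z))`, as a formal series of vector fields. -/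
def epsLorentz {M : MagneticField} (C : KruskalCoordinates M) : Formal (ℝ × R5 → ℝ × R5)
  | 0 => fun z => (C.Ωm z.2, 0)
  | 1 => fun z => (C.Ω₀ z, C.U₀ z)
  | _ + 2 => fun _ => 0

/-- `ε` times the vector field `ζ̇ = ε⁻¹ Ω₋₁(ξ) + Ω̄_ε(ξ)`, `ξ̇ = Ū_ε(ξ)`, as a formal series of
functions of `ξ`. -/
def epsDecoupled (Ωm : R5 → ℝ) (Ωbar : Formal (R5 → ℝ)) (Ubar : Formal (R5 → R5)) :
    Formal (R5 → ℝ × R5)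
  | 0 => fun ξ => (Ωm ξ, 0)
  | n + 1 => fun ξ => (Ωbar n ξ, Ubar n ξ)

/-- A formal near-identity transformation `Φ_ε = id + ε φ₁ + ε² φ₂ + ⋯` with formal inverse
`Ψ_ε = id + ε ψ₁ + ⋯`, that transforms the Lorentz force equation, to all orders in `ε`, into the
all-orders guiding center equations
`ζ̇ = ε⁻¹ Ω₋₁(ξ) + Ω̄_ε(ξ)`, `ξ̇ = Ū_ε(ξ)`. -/
structure KruskalTransformation {M : MagneticField} (C : KruskalCoordinates M) where
  φ : Formal (ℝ × R5 → ℝ × R5)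
  ψ : Formal (ℝ × R5 → ℝ × R5)
  Ωbar : Formal (R5 → ℝ)
  Ubar : Formal (R5 → R5)
  φ_smooth : ∀ k, ContDiffOn ℝ ∞ (φ k) (Set.univ ×ˢ C.D)
  ψ_smooth : ∀ k, ContDiffOn ℝ ∞ (ψ k) (Set.univ ×ˢ C.D)
  Ωbar_smooth : ∀ k, ContDiffOn ℝ ∞ (Ωbar k) C.D
  Ubar_smooth : ∀ k, ContDiffOn ℝ ∞ (Ubar k) C.D
  φ_zero : ∀ z ∈ (Set.univ ×ˢ C.D : Set (ℝ × R5)), φ 0 z = z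
  ψ_zero : ∀ z ∈ (Set.univ ×ˢ C.D : Set (ℝ × R5)), ψ 0 z = z
  φ_periodic : ∀ k, ∀ ζ : ℝ, ∀ ξ ∈ C.D, φ (k + 1) (ζ + 2 * Real.pi, ξ) = φ (k + 1) (ζ, ξ)
  ψ_periodic : ∀ k, ∀ ζ : ℝ, ∀ ξ ∈ C.D, ψ (k + 1) (ζ + 2 * Real.pi, ξ) = ψ (k + 1) (ζ, ξ)
  φ_ψ : ∀ z ∈ (Set.univ ×ˢ C.D : Set (ℝ × R5)), subst φ (fun k => ψ k z) = constSeries z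
  ψ_φ : ∀ z ∈ (Set.univ ×ˢ C.D : Set (ℝ × R5)), subst ψ (fun k => φ k z) = constSeries z
  /-- The identity `DΦ_ε(z)[ε Y_ε(z)] = ε W_ε(Φ_ε(z))` of formal series, `Y_ε` being the Lorentz force
  vector field in the coordinates `z = (ζ, ξ)` and `W_ε` the all-orders guiding center field. -/
  decouples : ∀ z ∈ (Set.univ ×ˢ C.D : Set (ℝ × R5)), ∀ n,
    ∑ p ∈ Finset.HasAntidiagonal.antidiagonal n, fderiv ℝ (φ p.1) z (epsLorentz C p.2 z) =
      subst (fun k z' => epsDecoupled C.Ωm Ωbar Ubar k z'.2) (fun k => φ k z) n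

/-! ### Loop space dynamics in the transformed variables -/

/-- `ε` times the generator of loop space dynamics, `∂ₜz̃ = W_ε(z̃) - Ω ∂_θz̃`, for the formal vector
field `W_ε = ε⁻¹ (w₀ + ε w₁ + ⋯)`, the frequency `Ω = ε⁻¹ freq` (the value of the frequency
functional at `z̃`) and the formal loop `z̃`. -/
def epsLoopSpaceGenerator (w : Formal (ℝ × R5 → ℝ × R5)) (freq : Formal ℝ)
    (z : Formal (ℝ → ℝ × R5)) : Formal (ℝ → ℝ × R5) := fun n θ =>
  subst w (fun k => z k θ) n -
    ∑ p ∈ Finset.HasAntidiagonal.antidiagonal n, freq p.1 • deriv (z p.2) θ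

/-- Slow variables `x = (ν̄, ξ̄, 𝒮)`, where `𝒮 = ε S`. -/
abbrev Slow : Type := ℝ × R5 × ℝ

section Dynamics

variable {M : MagneticField} {C : KruskalCoordinates M} (K : KruskalTransformation C)

/-- The values of the slow variables. -/
def slowDomain (C : KruskalCoordinates M) : Set Slow := {x | x.2.1 ∈ C.D}

/-- The fluctuating loops `(ν̂, ϱ̂)`: smooth, `2π`-periodic, with zero mean. -/
def IsFluctuation (h : ℝ → ℝ × R5) : Prop :=
  ContDiff ℝ ∞ h ∧ Function.Periodic h (2 * Real.pi) ∧ loopMean h = 0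

/-- The formal loop `(ζ̃, ξ̃)` with slow variables `(ν̄, ξ̄, 𝒮)` and fast variables
`(ν̂, ϱ̂)`, the latter a formal series: `ζ̃(θ) = θ + ν̄ + ν̂(θ)`, `ξ̃(θ) = ξ̄ + ε ϱ̂(θ)`. -/
def loopOf (x : Slow) (y : Formal (ℝ → ℝ × R5)) : Formal (ℝ → ℝ × R5)
  | 0 => fun θ => (θ + x.1 + (y 0 θ).1, x.2.1)
  | n + 1 => fun θ => ((y (n + 1) θ).1, (y n θ).2)

/-- `ω_c(ζ̃, ξ̃) = Ω₋₁(mean of ξ̃)`, evaluated at a formal loop. -/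
def omegaC (C : KruskalCoordinates M) (z : Formal (ℝ → ℝ × R5)) : Formal ℝ :=
  substFun C.Ωm fun n => loopMean fun θ => (z n θ).2

/-- The formal loop `Φ̃_ε⁻¹(ζ̃, ξ̃)`, the inverse transformation being applied pointwise in `θ`. -/
def inverseLoop (z : Formal (ℝ → ℝ × R5)) : Formal (ℝ → ℝ × R5) := fun n θ =>
  subst K.ψ (fun k => z k θ) n

/-- The series `ε ∂ₜ(ζ̃, ξ̃)` for loop space dynamics in the transformed variables:
`ε ∂ₜζ̃ = Ω₋₁(ξ̃) + ε Ω̄_ε(ξ̃) - ω ∂_θζ̃`, `ε ∂ₜξ̃ = ε Ū_ε(ξ̃) - ω ∂_θξ̃`, with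
`ω = ω_c(Φ̃_ε⁻¹(ζ̃, ξ̃))`. -/
def epsLoopGenerator (z : Formal (ℝ → ℝ × R5)) : Formal (ℝ → ℝ × R5) :=
  epsLoopSpaceGenerator (fun k z' => epsDecoupled C.Ωm K.Ωbar K.Ubar k z'.2)
    (omegaC C (inverseLoop K z)) z

/-- The mean part `ε d/dt (ν̄, ξ̄)` of the loop generator. -/
def epsMeanGenerator (x : Slow) (y : Formal (ℝ → ℝ × R5)) : Formal (ℝ × R5) := fun n =>
  loopMean (epsLoopGenerator K (loopOf x y) n)

/-- The fluctuating part `ε ∂ₜ(ν̂, ε ϱ̂)` of the loop generator. -/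
def epsFluctGenerator (x : Slow) (y : Formal (ℝ → ℝ × R5)) : Formal (ℝ → ℝ × R5) := fun n θ =>
  epsLoopGenerator K (loopOf x y) n θ - epsMeanGenerator K x y n

/-- `g_ε(x, y)`, the generator `(dν̄/dt, dξ̄/dt, d𝒮/dt)` of the slow variables, where
`d𝒮/dt = ε dS/dt = ω_c(Φ̃_ε⁻¹(ζ̃, ξ̃))`. The first two components are obtained by dividing
`epsMeanGenerator` by `ε`; the theorem asserts that this division is exact. -/
def slowGenerator (x : Slow) (y : Formal (ℝ → ℝ × R5)) : Formal Slow := fun n =>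
  ((epsMeanGenerator K x y (n + 1)).1, (epsMeanGenerator K x y (n + 1)).2,
    omegaC C (inverseLoop K (loopOf x y)) n)

/-- `f_ε(x, y) = ε (∂ₜν̂, ∂ₜϱ̂)`, the generator of the fast variables times `ε`. Its second component
is obtained by dividing that of `epsFluctGenerator` by `ε`; the theorem asserts that this division
is exact. -/
def fastGenerator (x : Slow) (y : Formal (ℝ → ℝ × R5)) : Formal (ℝ → ℝ × R5) := fun n θ =>
  ((epsFluctGenerator K x y n θ).1, (epsFluctGenerator K x y (n + 1) θ).2)

/-- The formal series `y*_ε(x) = y*₀(x) + ε y*₁(x) + ⋯`, whose coefficients are smooth functions of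
`x` with values in the fluctuating loops, is a formal slow manifold: it solves the invariance
equation `ε Dy*_ε(x)[g_ε(x, y*_ε(x))] = f_ε(x, y*_ε(x))` to all orders in `ε`. -/
structure IsFormalSlowManifold (y : Formal (Slow → ℝ → ℝ × R5)) : Prop where
  smooth : ∀ k, ContDiffOn ℝ ∞ (fun p : Slow × ℝ => y k p.1 p.2) (slowDomain C ×ˢ Set.univ)
  fluctuation : ∀ k, ∀ x ∈ slowDomain C, IsFluctuation (y k x)
  invariance : ∀ x ∈ slowDomain C, ∀ n θ,
    epsMul (fun m => ∑ p ∈ Finset.HasAntidiagonal.antidiagonal m,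
        fderiv ℝ (fun x' => y p.1 x' θ) x (slowGenerator K x (fun k => y k x) p.2)) n =
      fastGenerator K x (fun k => y k x) n θ

/-- The series `ω_c(Φ̃_ε⁻¹(ζ̃*, ξ̃*))` for the loop `ζ̃*(θ) = θ + ν̄`, `ξ̃*(θ) = ξ̄`. -/
def slowFrequency (ν : ℝ) (ξ : R5) : Formal ℝ :=
  omegaC C (inverseLoop K (constSeries fun θ => (θ + ν, ξ)))

/-- The series `Ω₋₁(ξ̄) - ω_c(Φ̃_ε⁻¹(ζ̃*, ξ̃*))`, which is `ε δω_ε(ν̄, ξ̄)`. -/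
def epsDeltaOmega (ν : ℝ) (ξ : R5) : Formal ℝ := fun n =>
  constSeries (C.Ωm ξ) n - slowFrequency K ν ξ n

/-- The series `δω_ε(ν̄, ξ̄)`. -/
def deltaOmega (ν : ℝ) (ξ : R5) : Formal ℝ := fun n => epsDeltaOmega K ν ξ (n + 1)

/-- The velocity `(dζ/dt, dξ/dt)` of `(ζ, ξ) = (ν̄ + 𝒮/ε, ξ̄)`, times `ε`, that is induced by a
velocity `v` of `(ν̄, ξ̄, 𝒮)`. -/
def epsInducedVelocity (v : Formal Slow) : Formal (ℝ × R5) := fun n =>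
  (epsMul (fun k => (v k).1) n + (v n).2.2, epsMul (fun k => (v k).2.1) n)

end Dynamics

end

end SlowLoops

/-! The fluctuation of `ξ` carries a factor `ε` and the inverse transformation is the identity at
leading order, so `ω = Ω₋₁(ξ̄) + O(ε)`. This cancels the leading drift of `ζ̃`, leaving `f₀ =
-Ω₋₁(ξ̄) ∂_θ y`, an operator that is injective on periodic loops of zero mean because `Ω₋₁(ξ̄) ≠ 0`.

Uniqueness is then an induction on the order. If `y*₀, …, y*ₙ₋₁` vanish, the prefactor `ε` leaves
nothing on the left of the invariance equation at order `n`, while on the right `y*ₙ` enters only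
through `-Ω₋₁(ξ̄) ∂_θ y*ₙ`, up to constants in `θ` (`eq_zero_of_fastGenerator_eq_zero`). Existence
holds because the transformed field does not involve `ζ`: on a loop without fluctuations the
generator is constant in `θ`, so it equals its mean and `f_ε = 0`. What remains of `g_ε` differs
from the guiding center field by the rotation `ω/ε`, which `ζ = ν̄ + 𝒮/ε` restores. -/

namespace SlowLoops

/-! ### Formal substitution, leading coefficients and periodic functions -/

section Series

variable {E G : Type*} [NormedAddCommGroup E] [NormedSpace ℝ E]
  [NormedAddCommGroup G] [NormedSpace ℝ G]

theorem loopMean_const [CompleteSpace E] (c : E) : loopMean (fun _ : ℝ => c) = c := by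
  have : (2 * Real.pi) ≠ 0 := by positivity
  simp only [loopMean, intervalIntegral.integral_const, sub_zero]
  rw [smul_smul, inv_mul_cancel₀ this, one_smul]

theorem substFun_zero (F : E → G) (a : Formal E) : substFun F a 0 = F (a 0) := by
  simp [substFun]

theorem subst_zero (F : Formal (E → G)) (a : Formal E) : subst F a 0 = F 0 (a 0) := by
  simp [subst, substFun_zero]

/-- Coefficient `n` sees only `a₀, …, aₙ`, so under `h` the argument of `F` does not depend on `ε`
and only the zeroth Taylor coefficient survives. No smoothness of `F` is needed. -/
theorem substFun_snd_of_vanish {E' : Type*} [NormedAddCommGroup E'] [NormedSpace ℝ E']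
    (F : E' → G) (a : Formal (E × E')) (n : ℕ) (h : ∀ k, k < n → (a (k + 1)).2 = 0) :
    substFun (fun z => F z.2) a n = constSeries (F (a 0).2) n := by
  have hsum : ∀ ε : ℝ, (∑ k ∈ Finset.range (n + 1), ε ^ k • a k).2 = (a 0).2 := by
    intro ε
    rw [Prod.snd_sum, Finset.sum_range_succ', Finset.sum_eq_zero]
    · simp
    · intro k hk
      simp [h k (Finset.mem_range.1 hk)]
  cases n with
  | zero => simp [substFun, constSeries]
  | succ n =>
    simp only [substFun, hsum, constSeries, iteratedDeriv_const]
    simp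

theorem subst_snd_of_vanish {E' : Type*} [NormedAddCommGroup E'] [NormedSpace ℝ E']
    (F : Formal (E' → G)) (a : Formal (E × E')) (n : ℕ) (h : ∀ k, k < n → (a (k + 1)).2 = 0) :
    subst (fun k z => F k z.2) a n = F n (a 0).2 := by
  unfold subst
  rw [Finset.sum_eq_single (n, 0)]
  · exact substFun_zero _ _
  · rintro ⟨i, j⟩ hij hne
    have hij' : i + j = n := Finset.HasAntidiagonal.mem_antidiagonal.1 hij
    cases j with
    | zero => exact absurd (by simp at hij' ⊢; exact hij') hne
    | succ j =>
      rw [substFun_snd_of_vanish (F i) a (j + 1) fun k hk => h k (by omega)]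
      rfl
  · simp

theorem deriv_snd_eq_zero {h : ℝ → E × G} (hh : ∀ t, (h t).2 = 0) (t : ℝ) :
    (deriv h t).2 = 0 := by
  by_cases hd : DifferentiableAt ℝ h t
  · have h1 : HasDerivAt (fun s => (h s).2) (deriv h t).2 t := by
      have := hd.hasFDerivAt.snd.hasDerivAt
      simpa using this
    rw [funext hh] at h1
    exact h1.unique (hasDerivAt_const t 0)
  -- Here `deriv` has its default value `0`, so no regularity of the first component is required.
  · rw [deriv_zero_of_not_differentiableAt hd]
    rfl

theorem iteratedDeriv_snd_eq_zero (n : ℕ) {h : ℝ → E × G} (hh : ∀ t, (h t).2 = 0) (t : ℝ) :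
    (iteratedDeriv n h t).2 = 0 := by
  induction n generalizing t with
  | zero => simpa using hh t
  | succ n ih =>
    rw [iteratedDeriv_succ]
    exact deriv_snd_eq_zero ih t

theorem substFun_snd_eq_zero {E' : Type*} [NormedAddCommGroup E'] [NormedSpace ℝ E']
    {F : E → E' × G} (hF : ∀ z, (F z).2 = 0) (a : Formal E) (n : ℕ) :
    (substFun F a n).2 = 0 := by
  simp only [substFun, Prod.smul_snd]
  rw [iteratedDeriv_snd_eq_zero n (fun t => hF _), smul_zero]

/-- The lowest order term of a Cauchy product is the product of the lowest order terms. -/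
theorem sum_antidiagonal_smul_of_vanish (f : ℕ → ℝ) (g : ℕ → E) (n : ℕ)
    (h : ∀ k, k < n → g k = 0) :
    ∑ p ∈ Finset.HasAntidiagonal.antidiagonal n, f p.1 • g p.2 = f 0 • g n := by
  rw [Finset.sum_eq_single (0, n)]
  · rintro ⟨i, j⟩ hij hne
    have hij' : i + j = n := Finset.HasAntidiagonal.mem_antidiagonal.1 hij
    rw [h j, smul_zero]
    by_contra hj
    exact hne (by ext <;> simp <;> omega)
  · simp

/-- A periodic function with constant derivative is constant. -/
theorem eq_of_periodic_of_deriv_const {f : ℝ → E} (hf : Differentiable ℝ f) {T : ℝ} (hT : T ≠ 0)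
    (hp : Function.Periodic f T) {c : E} (hc : ∀ t, deriv f t = c) (t : ℝ) : f t = f 0 := by
  have hd : ∀ s, HasDerivAt (fun s => f s - s • c) 0 s := fun s => by
    have h1 := (hf s).hasDerivAt.sub ((hasDerivAt_id s).smul_const c)
    rw [hc, one_smul, sub_self] at h1
    exact h1
  have hconst : ∀ s, f s - s • c = f 0 := fun s => by
    have := is_const_of_deriv_eq_zero (fun s => (hd s).differentiableAt) (fun s => (hd s).deriv) s 0
    simpa using this
  -- The linear growth `T • c` over one period contradicts periodicity unless `c = 0`.
  have hc0 : c = 0 := by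
    have h1 := hconst T
    have h2 : f T = f 0 := by simpa using hp 0
    rw [h2, sub_eq_self] at h1
    exact (smul_eq_zero.1 h1).resolve_left hT
  simpa [hc0] using hconst t

end Series

/-! ### Fluctuating loops and the leading order of the loop generator -/

section Loops

/-- Periodicity makes the loop constant, and a constant of zero mean is zero. This is the
injectivity of `∂_θ`, modulo constants, on fluctuations. -/
theorem IsFluctuation.eq_zero_of_deriv_const {h : ℝ → ℝ × R5} (hh : IsFluctuation h) {a : ℝ}
    {b : R5} (ha : ∀ t, deriv (fun s => (h s).1) t = a) (hb : ∀ t, deriv (fun s => (h s).2) t = b)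
    (t : ℝ) : h t = 0 := by
  obtain ⟨hs, hp, hm⟩ := hh
  have hd : Differentiable ℝ h := hs.differentiable (by simp)
  have hT : 2 * Real.pi ≠ 0 := by positivity
  have h1 := eq_of_periodic_of_deriv_const hd.fst hT (fun s => congrArg Prod.fst (hp s)) ha
  have h2 := eq_of_periodic_of_deriv_const hd.snd hT (fun s => congrArg Prod.snd (hp s)) hb
  have h3 : h = fun _ => h 0 := funext fun s => Prod.ext (h1 s) (h2 s)
  rw [h3, loopMean_const] at hm
  rw [h3]
  exact hm

theorem isFluctuation_zero : IsFluctuation (fun _ => 0) :=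
  ⟨contDiff_const, fun _ => rfl, loopMean_const 0⟩

theorem loopMean_deriv_fst {h : ℝ → ℝ × R5} (hh : IsFluctuation h) (c : ℝ) :
    loopMean (fun θ => (c * deriv (fun s => (h s).1) θ, (0 : R5))) = 0 := by
  obtain ⟨hs, hp, -⟩ := hh
  have hs1 : ContDiff ℝ ∞ (fun s => (h s).1) := contDiff_fst.comp hs
  have hd : Differentiable ℝ (fun s => (h s).1) := hs1.differentiable (by simp)
  have hc : Continuous (deriv fun s => (h s).1) := hs1.continuous_deriv (by simp)
  have hderiv : ∀ θ ∈ Set.uIcc 0 (2 * Real.pi),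
      HasDerivAt (fun θ => (c * (h θ).1, (0 : R5))) (c * deriv (fun s => (h s).1) θ, 0) θ :=
    fun θ _ => ((hd θ).hasDerivAt.const_mul c).prodMk (hasDerivAt_const θ 0)
  have hint : (∫ θ in (0 : ℝ)..(2 * Real.pi), (c * deriv (fun s => (h s).1) θ, (0 : R5))) = 0 := by
    rw [intervalIntegral.integral_eq_sub_of_hasDerivAt hderiv
      (Continuous.intervalIntegrable (by fun_prop) _ _)]
    have : h (2 * Real.pi) = h 0 := by simpa using hp 0
    simp [this]
  rw [loopMean, hint, smul_zero]

variable {M : MagneticField} {C : KruskalCoordinates M} (K : KruskalTransformation C)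

theorem isOpen_slowDomain (C : KruskalCoordinates M) : IsOpen (slowDomain C) :=
  C.isOpen_D.preimage (by fun_prop : Continuous fun x : Slow => x.2.1)

theorem deriv_loopOf_zero (x : Slow) {y : Formal (ℝ → ℝ × R5)} (hy : IsFluctuation (y 0)) (θ : ℝ) :
    deriv (loopOf x y 0) θ = (1 + deriv (fun s => (y 0 s).1) θ, 0) := by
  have hd : DifferentiableAt ℝ (y 0) θ := hy.1.differentiable (by simp) θ
  exact ((((hasDerivAt_id θ).add_const x.1).add hd.fst.hasDerivAt).prodMk
    (hasDerivAt_const θ x.2.1)).deriv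

theorem deriv_loopOf_succ (x : Slow) {y : Formal (ℝ → ℝ × R5)} (hy : ∀ k, IsFluctuation (y k))
    (n : ℕ) (θ : ℝ) :
    deriv (loopOf x y (n + 1)) θ =
      (deriv (fun s => (y (n + 1) s).1) θ, deriv (fun s => (y n s).2) θ) := by
  have hd : ∀ k, DifferentiableAt ℝ (y k) θ := fun k => (hy k).1.differentiable (by simp) θ
  exact ((hd (n + 1)).fst.hasDerivAt.prodMk (hd n).snd.hasDerivAt).deriv

theorem deriv_loopOf_fst (x : Slow) {y : Formal (ℝ → ℝ × R5)} (hy : ∀ k, IsFluctuation (y k))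
    (n : ℕ) (θ : ℝ) :
    (deriv (loopOf x y n) θ).1 = constSeries 1 n + deriv (fun s => (y n s).1) θ := by
  cases n with
  | zero => rw [deriv_loopOf_zero x (hy 0)]; rfl
  | succ n => rw [deriv_loopOf_succ x hy]; simp [constSeries]

theorem sum_antidiagonal_mul_constSeries_one (f : Formal ℝ) (n : ℕ) :
    ∑ p ∈ Finset.HasAntidiagonal.antidiagonal n, f p.1 * (constSeries 1 p.2 : ℝ) = f n := by
  cases n with
  | zero => simp [constSeries]
  | succ n => simp [Finset.Nat.sum_antidiagonal_succ', constSeries]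

theorem omegaC_inverseLoop_zero {x : Slow} (hx : x ∈ slowDomain C) (y : Formal (ℝ → ℝ × R5)) :
    omegaC C (inverseLoop K (loopOf x y)) 0 = C.Ωm x.2.1 := by
  have h : ∀ θ, (inverseLoop K (loopOf x y) 0 θ).2 = x.2.1 := fun θ => by
    have hz : loopOf x y 0 θ ∈ (Set.univ ×ˢ C.D : Set (ℝ × R5)) := ⟨Set.mem_univ _, hx⟩
    rw [inverseLoop, subst_zero, K.ψ_zero _ hz]
    rfl
  rw [omegaC, substFun_zero]
  simp only [h, loopMean_const]

/-- The drift `Ω₋₁(ξ̄)` cancels against `ω · 1`, where `1` is the `θ`-derivative of the winding part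
of `ζ̃`. What is left has zero mean and no `ξ` component, which makes the divisions by `ε` exact. -/
theorem epsLoopGenerator_zero {x : Slow} (hx : x ∈ slowDomain C) {y : Formal (ℝ → ℝ × R5)}
    (hy : ∀ k, IsFluctuation (y k)) (θ : ℝ) :
    epsLoopGenerator K (loopOf x y) 0 θ =
      (-C.Ωm x.2.1 * deriv (fun s => (y 0 s).1) θ, 0) := by
  simp only [epsLoopGenerator, epsLoopSpaceGenerator, subst_zero,
    Finset.Nat.antidiagonal_zero, Finset.sum_singleton, omegaC_inverseLoop_zero K hx,
    deriv_loopOf_zero x (hy 0), epsDecoupled]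
  simp only [loopOf]
  ext1
  · simp; ring
  · simp

theorem epsMeanGenerator_zero {x : Slow} (hx : x ∈ slowDomain C) {y : Formal (ℝ → ℝ × R5)}
    (hy : ∀ k, IsFluctuation (y k)) : epsMeanGenerator K x y 0 = 0 := by
  rw [epsMeanGenerator, funext (epsLoopGenerator_zero K hx hy)]
  exact loopMean_deriv_fst (hy 0) _

theorem epsFluctGenerator_zero_snd {x : Slow} (hx : x ∈ slowDomain C) {y : Formal (ℝ → ℝ × R5)}
    (hy : ∀ k, IsFluctuation (y k)) (θ : ℝ) : (epsFluctGenerator K x y 0 θ).2 = 0 := by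
  rw [epsFluctGenerator, epsMeanGenerator_zero K hx hy, epsLoopGenerator_zero K hx hy]
  simp

/-! ### The leading order part of a fluctuation -/

variable {x : Slow} {y : Formal (ℝ → ℝ × R5)} {n : ℕ}

/-- The `ξ` coefficients of the loop at orders `1, …, n` are the vanishing `ϱ̂₀, …, ϱ̂ₙ₋₁`, so the
field is evaluated at `ξ̄`. The coefficient of `ω` may depend on `yₙ`, but it is constant in `θ` and
need not be computed. -/
theorem epsLoopGenerator_fst_of_vanish (hx : x ∈ slowDomain C) (hy : ∀ k, IsFluctuation (y k))
    (h : ∀ k, k < n → ∀ θ, y k θ = 0) (θ : ℝ) :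
    (epsLoopGenerator K (loopOf x y) n θ).1 =
      (epsDecoupled C.Ωm K.Ωbar K.Ubar n x.2.1).1 - omegaC C (inverseLoop K (loopOf x y)) n -
        C.Ωm x.2.1 * deriv (fun s => (y n s).1) θ := by
  have hz : ∀ k, k < n → (loopOf x y (k + 1) θ).2 = 0 := fun k hk => by simp [loopOf, h k hk]
  have hsum := sum_antidiagonal_smul_of_vanish (omegaC C (inverseLoop K (loopOf x y)))
    (fun k => deriv (fun s => (y k s).1) θ) n (fun k hk => by simp [h k hk])
  rw [omegaC_inverseLoop_zero K hx] at hsum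
  simp only [smul_eq_mul] at hsum
  rw [epsLoopGenerator, epsLoopSpaceGenerator, subst_snd_of_vanish _ _ _ hz, Prod.fst_sub,
    Prod.fst_sum]
  simp only [Prod.smul_fst, deriv_loopOf_fst x hy, smul_eq_mul, mul_add, Finset.sum_add_distrib,
    sum_antidiagonal_mul_constSeries_one, hsum, ← sub_sub]
  rfl

/-- The order is `n + 1` because `ϱ̂ₙ` sits at order `n + 1` of the loop. The `ξ` component of `ε
W_ε` starts at order `1`, so `ϱ̂ₙ` affects it only from order `n + 2` on. -/
theorem epsLoopGenerator_snd_of_vanish (hx : x ∈ slowDomain C) (hy : ∀ k, IsFluctuation (y k))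
    (h : ∀ k, k < n → ∀ θ, y k θ = 0) (θ : ℝ) :
    (epsLoopGenerator K (loopOf x y) (n + 1) θ).2 =
      K.Ubar n x.2.1 - C.Ωm x.2.1 • deriv (fun s => (y n s).2) θ := by
  have hz : ∀ k, k < n → (loopOf x y (k + 1) θ).2 = 0 := fun k hk => by simp [loopOf, h k hk]
  have hsum := sum_antidiagonal_smul_of_vanish (omegaC C (inverseLoop K (loopOf x y)))
    (fun k => deriv (fun s => (y k s).2) θ) n (fun k hk => by simp [h k hk])
  rw [omegaC_inverseLoop_zero K hx] at hsum
  have hw := subst_snd_of_vanish (fun k => epsDecoupled C.Ωm K.Ωbar K.Ubar (k + 1))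
    (fun k => loopOf x y k θ) n hz
  rw [subst] at hw
  -- Split off the term of the leading field in the first sum and of the leading loop in the second:
  -- neither has a `ξ` component.
  rw [epsLoopGenerator, epsLoopSpaceGenerator, subst, Finset.Nat.sum_antidiagonal_succ,
    Finset.Nat.sum_antidiagonal_succ', hw, Prod.snd_sub, Prod.snd_add, Prod.snd_add,
    substFun_snd_eq_zero (fun _ => rfl), Prod.snd_sum, Prod.smul_snd, deriv_loopOf_zero x (hy 0)]
  simp only [Prod.smul_snd, deriv_loopOf_succ x hy, hsum]
  simp [epsDecoupled, loopOf]

/-- A vanishing fast generator means that the loop generator equals its mean; the two preceding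
formulas then make `Ω₋₁(ξ̄) ∂_θ yₙ` constant in `θ`. -/
theorem eq_zero_of_fastGenerator_eq_zero (hx : x ∈ slowDomain C) (hy : ∀ k, IsFluctuation (y k))
    (h : ∀ k, k < n → ∀ θ, y k θ = 0) (hf : ∀ θ, fastGenerator K x y n θ = 0) (θ : ℝ) :
    y n θ = 0 := by
  have hΩ : C.Ωm x.2.1 ≠ 0 := C.Ωm_ne_zero _ hx
  have h1 : ∀ t, (epsLoopGenerator K (loopOf x y) n t).1 = (epsMeanGenerator K x y n).1 :=
    fun t => sub_eq_zero.1 (congrArg Prod.fst (hf t))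
  have h2 : ∀ t, (epsLoopGenerator K (loopOf x y) (n + 1) t).2 =
      (epsMeanGenerator K x y (n + 1)).2 := fun t => sub_eq_zero.1 (congrArg Prod.snd (hf t))
  simp only [epsLoopGenerator_fst_of_vanish K hx hy h] at h1
  simp only [epsLoopGenerator_snd_of_vanish K hx hy h] at h2
  refine (hy n).eq_zero_of_deriv_const (a := deriv (fun s => (y n s).1) 0)
    (b := deriv (fun s => (y n s).2) 0) (fun t => ?_) (fun t => ?_) θ
  · exact mul_left_cancel₀ hΩ (sub_right_injective ((h1 t).trans (h1 0).symm))
  · exact smul_right_injective _ hΩ (sub_right_injective ((h2 t).trans (h2 0).symm))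

/-! ### Loops without fluctuations -/

theorem loopOf_zero (x : Slow) :
    loopOf x (fun _ _ => 0) = constSeries fun θ => (θ + x.1, x.2.1) := by
  funext n
  cases n with
  | zero => simp [loopOf, constSeries]
  | succ n => rfl

theorem epsLoopGenerator_loopOf_zero (hx : x ∈ slowDomain C) (n : ℕ) (θ : ℝ) :
    epsLoopGenerator K (loopOf x fun _ _ => 0) n θ =
      ((epsDecoupled C.Ωm K.Ωbar K.Ubar n x.2.1).1 - slowFrequency K x.1 x.2.1 n,
        (epsDecoupled C.Ωm K.Ωbar K.Ubar n x.2.1).2) := by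
  have hy : ∀ k : ℕ, IsFluctuation ((fun _ _ => 0 : Formal (ℝ → ℝ × R5)) k) :=
    fun _ => isFluctuation_zero
  ext1
  · rw [epsLoopGenerator_fst_of_vanish K hx hy (fun _ _ _ => rfl), loopOf_zero]
    simp [slowFrequency]
  · cases n with
    | zero => rw [epsLoopGenerator_zero K hx hy]; rfl
    | succ n =>
      rw [epsLoopGenerator_snd_of_vanish K hx hy (fun _ _ _ => rfl)]
      simp [epsDecoupled]

theorem epsMeanGenerator_fluct_zero (hx : x ∈ slowDomain C) (n : ℕ) :
    epsMeanGenerator K x (fun _ _ => 0) n =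
      ((epsDecoupled C.Ωm K.Ωbar K.Ubar n x.2.1).1 - slowFrequency K x.1 x.2.1 n,
        (epsDecoupled C.Ωm K.Ωbar K.Ubar n x.2.1).2) := by
  rw [epsMeanGenerator, funext (epsLoopGenerator_loopOf_zero K hx n), loopMean_const]

theorem fastGenerator_fluct_zero (hx : x ∈ slowDomain C) (n : ℕ) (θ : ℝ) :
    fastGenerator K x (fun _ _ => 0) n θ = 0 := by
  simp only [fastGenerator, epsFluctGenerator, epsLoopGenerator_loopOf_zero K hx,
    epsMeanGenerator_fluct_zero K hx, sub_self]

theorem slowGenerator_fluct_zero (hx : x ∈ slowDomain C) (n : ℕ) :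
    slowGenerator K x (fun _ _ => 0) n =
      (K.Ωbar n x.2.1 + deltaOmega K x.1 x.2.1 n, K.Ubar n x.2.1,
        slowFrequency K x.1 x.2.1 n) := by
  rw [slowGenerator, epsMeanGenerator_fluct_zero K hx, loopOf_zero]
  simp [deltaOmega, epsDeltaOmega, constSeries, epsDecoupled, slowFrequency, sub_eq_add_neg]

theorem slowFrequency_zero (ν : ℝ) {ξ : R5} (hξ : ξ ∈ C.D) : slowFrequency K ν ξ 0 = C.Ωm ξ := by
  have hx : ((ν, ξ, 0) : Slow) ∈ slowDomain C := hξ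
  have h := omegaC_inverseLoop_zero K hx fun _ _ => 0
  rw [loopOf_zero] at h
  exact h

/-! ### The formal slow manifold -/

theorem fderiv_eq_zero_of_vanish {f : Slow → ℝ × R5} (hf : ∀ x' ∈ slowDomain C, f x' = 0)
    (hx : x ∈ slowDomain C) : fderiv ℝ f x = 0 := by
  have h : f =ᶠ[nhds x] fun _ => 0 :=
    Filter.eventually_of_mem ((isOpen_slowDomain C).mem_nhds hx) hf
  rw [h.fderiv_eq]
  simp

theorem IsFormalSlowManifold.eq_zero {ystar : Formal (Slow → ℝ → ℝ × R5)}
    (hs : IsFormalSlowManifold K ystar) (k : ℕ) :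
    ∀ x ∈ slowDomain C, ∀ θ, ystar k x θ = 0 := by
  induction k using Nat.strong_induction_on with
  | _ n ih =>
    intro x hx θ
    refine eq_zero_of_fastGenerator_eq_zero K (y := fun k => ystar k x) hx
      (fun k => hs.fluctuation k x hx) (fun k hk => ih k hk x hx) (fun θ => ?_) θ
    rw [← hs.invariance x hx n θ]
    cases n with
    | zero => rfl
    | succ n =>
      -- The shift by `ε` leaves only derivatives of coefficients of order at most `n`, which vanish
      -- on the open slow domain by induction.
      refine Finset.sum_eq_zero fun p hp => ?_
      have hp' : p.1 + p.2 = n := Finset.HasAntidiagonal.mem_antidiagonal.1 hp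
      rw [fderiv_eq_zero_of_vanish (fun x' hx' => ih p.1 (by omega) x' hx' θ) hx]
      rfl

theorem isFormalSlowManifold_of_eq_zero {ystar : Formal (Slow → ℝ → ℝ × R5)}
    (h : ∀ k, ∀ x ∈ slowDomain C, ∀ θ, ystar k x θ = 0) : IsFormalSlowManifold K ystar where
  smooth k := contDiffOn_const.congr fun p hp => h k p.1 hp.1 p.2
  fluctuation k x hx := by
    rw [funext (h k x hx)]
    exact isFluctuation_zero
  invariance x hx n θ := by
    have hy : (fun k => ystar k x) = fun _ _ => 0 := funext fun k => funext (h k x hx)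
    rw [hy, fastGenerator_fluct_zero K hx]
    cases n with
    | zero => rfl
    | succ n =>
      refine Finset.sum_eq_zero fun p _ => ?_
      rw [fderiv_eq_zero_of_vanish (fun x' hx' => h p.1 x' hx' θ) hx]
      rfl

/-! ### Equivalence with guiding center dynamics -/

/-- Beyond order `0`, `ε δω_ε` is minus the frequency series, so adding `𝒮̇/ε` to `ν̄̇` removes it;
at order `0` the frequency is `Ω₋₁(ξ)` itself. -/
theorem velocity_eq_iff_epsInducedVelocity {ν : ℝ} {ξ : R5} (hξ : ξ ∈ C.D) (v : Formal Slow) :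
    (∀ n, v n = (K.Ωbar n ξ + deltaOmega K ν ξ n, K.Ubar n ξ, slowFrequency K ν ξ n)) ↔
      (∀ n, epsInducedVelocity v n = epsDecoupled C.Ωm K.Ωbar K.Ubar n ξ) ∧
        ∀ n, (v n).2.2 = slowFrequency K ν ξ n := by
  have hδ : ∀ n, deltaOmega K ν ξ n = -slowFrequency K ν ξ (n + 1) := fun n => by
    simp [deltaOmega, epsDeltaOmega, constSeries]
  constructor
  · intro hv
    refine ⟨fun n => ?_, fun n => by rw [hv]⟩
    cases n with
    | zero => simp [epsInducedVelocity, epsMul, epsDecoupled, hv, slowFrequency_zero K ν hξ]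
    | succ n => simp [epsInducedVelocity, epsMul, epsDecoupled, hv, hδ]
  · rintro ⟨h1, h2⟩ n
    -- Order `n + 1` of the `ε`-multiplied equation determines the velocity of `(ν̄, ξ̄)` at order
    -- `n`.
    have h3 := h1 (n + 1)
    simp only [epsInducedVelocity, epsMul, epsDecoupled, h2, Prod.mk.injEq] at h3
    refine Prod.ext ?_ (Prod.ext h3.2 (h2 n))
    simp only [hδ, ← h3.1]
    ring

end Loops

end SlowLoops

theorem theorem3 (M : SlowLoops.MagneticField) (C : SlowLoops.KruskalCoordinates M)
    (K : SlowLoops.KruskalTransformation C) :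
    -- the series defining `g_ε` and `f_ε` contain no negative powers of `ε`
    (∀ x ∈ SlowLoops.slowDomain C, ∀ y : SlowLoops.Formal (ℝ → ℝ × SlowLoops.R5),
      (∀ k, SlowLoops.IsFluctuation (y k)) →
        SlowLoops.epsMeanGenerator K x y 0 = 0 ∧
        ∀ θ, (SlowLoops.epsFluctGenerator K x y 0 θ).2 = 0) ∧
    -- `y*_ε = 0` is the unique formal slow manifold
    (∀ ystar : SlowLoops.Formal (SlowLoops.Slow → ℝ → ℝ × SlowLoops.R5),
      SlowLoops.IsFormalSlowManifold K ystar ↔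
        ∀ k, ∀ x ∈ SlowLoops.slowDomain C, ∀ θ, ystar k x θ = 0) ∧
    (∀ ystar : SlowLoops.Formal (SlowLoops.Slow → ℝ → ℝ × SlowLoops.R5),
      SlowLoops.IsFormalSlowManifold K ystar →
      ∀ (ν : ℝ), ∀ ξ ∈ C.D, ∀ S : ℝ,
        -- the generator on the formal slow manifold
        (∀ n, SlowLoops.slowGenerator K (ν, ξ, S) (fun k => ystar k (ν, ξ, S)) n =
          (K.Ωbar n ξ + SlowLoops.deltaOmega K ν ξ n, K.Ubar n ξ,
            SlowLoops.slowFrequency K ν ξ n)) ∧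
        -- `δω_ε = O(1)`
        SlowLoops.epsDeltaOmega K ν ξ 0 = 0 ∧
        -- the motion of `(ν, ξ)` decouples from `S`, and the slow equations are equivalent to the
        -- all-orders guiding center equations for `(ζ, ξ) = (ν + S/ε, ξ)` with the equation of `S`
        (∀ S' : ℝ, ∀ n,
          (SlowLoops.slowGenerator K (ν, ξ, S') (fun k => ystar k (ν, ξ, S')) n).1 =
            (SlowLoops.slowGenerator K (ν, ξ, S) (fun k => ystar k (ν, ξ, S)) n).1 ∧
          (SlowLoops.slowGenerator K (ν, ξ, S') (fun k => ystar k (ν, ξ, S')) n).2.1 =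
            (SlowLoops.slowGenerator K (ν, ξ, S) (fun k => ystar k (ν, ξ, S)) n).2.1) ∧
        (∀ v : SlowLoops.Formal SlowLoops.Slow,
          v = SlowLoops.slowGenerator K (ν, ξ, S) (fun k => ystar k (ν, ξ, S)) ↔
            (∀ n, SlowLoops.epsInducedVelocity v n = SlowLoops.epsDecoupled C.Ωm K.Ωbar K.Ubar n ξ) ∧
            ∀ n, (v n).2.2 = SlowLoops.slowFrequency K ν ξ n)) := by
  refine ⟨fun x hx y hy => ⟨SlowLoops.epsMeanGenerator_zero K hx hy,
    SlowLoops.epsFluctGenerator_zero_snd K hx hy⟩, fun ystar => ⟨fun h => h.eq_zero,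
    SlowLoops.isFormalSlowManifold_of_eq_zero K⟩, fun ystar hs ν ξ hξ S => ?_⟩
  have hgen : ∀ S n, SlowLoops.slowGenerator K (ν, ξ, S) (fun k => ystar k (ν, ξ, S)) n =
      (K.Ωbar n ξ + SlowLoops.deltaOmega K ν ξ n, K.Ubar n ξ,
        SlowLoops.slowFrequency K ν ξ n) := fun S n => by
    have hx : ((ν, ξ, S) : SlowLoops.Slow) ∈ SlowLoops.slowDomain C := hξ
    have hy : (fun k => ystar k (ν, ξ, S)) = fun _ _ => 0 :=
      funext fun k => funext (hs.eq_zero K k _ hx)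
    rw [hy, SlowLoops.slowGenerator_fluct_zero K hx]
  refine ⟨hgen S, ?_, fun S' n => ?_, fun v => ?_⟩
  · simp [SlowLoops.epsDeltaOmega, SlowLoops.constSeries, SlowLoops.slowFrequency_zero K ν hξ]
  · simp only [hgen, and_self]
  · rw [← SlowLoops.velocity_eq_iff_epsInducedVelocity K hξ, funext_iff]
    simp only [hgen]
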